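/- Let $\mathcal X$ be a Polish space with its Borel $\sigma$-field, let $\mathrm P(\mathcal X)$ be the set of Borel probability measures on $\mathcal X$, let $c:\mathcal X\times\mathcal X\to[0,\infty)$ be a lower semicontinuous cost function, and let $\mu\in\mathrm P(\mathcal X)$. For a bounded Borel function $f:\mathcal X\to\mathbb R$ put $Q_cf(x)=\inf_{y\in\mathcal X}\{f(y)+c(x,y)\}$. For $\nu_1,\nu_2\in\mathrm P(\mathcal X)$ let $$\mathcal T_c(\nu_1,\nu_2)=\inf\Big\{\int_{\mathcal X^2}c(x,y)\,d\pi(x,y)\;:\;\pi\in\mathrm P(\mathcal X^2)\text{ with first marginal }\nu_1\text{ and second marginal }\nu_2\Big\}\in[0,\infty]$$ and let $H(\nu|\mu)=\int\log\frac{d\nu}{d\mu}\,d\nu$ if $\nu\ll\mu$, and $H(\nu|\mu)=+\infty$ otherwise, be the relative entropy. Then the following are equivalent: 1. the couple $(\mu,c)$ satisfies Property $(\tau)$, i.e. for every bounded Borel function $f:\mathcal X\to\mathbb R$, $$\Big(\int e^{Q_cf}\,d\mu\Big)\Big(\int e^{-f}\,d\mu\Big)\le 1;$$ 2. for all $\nu_1,\nu_2\in\mathrm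 P(\mathcal X)$, $$\mathcal T_c(\nu_1,\nu_2)\le H(\nu_1|\mu)+H(\nu_2|\mu).$$ (The integrals in 1 are taken in $[0,\infty]$; the function $Q_cf$ is universally measurable.) -/

import Mathlib

open MeasureTheory
open scoped ENNReal NNReal

noncomputable section

namespace TransportEntropy

variable {X : Type*}

/-- The optimal transport cost `T_c(ν₁, ν₂)`: the infimum of `∫ c dπ` over all probability
measures `π` on `X × X` with first marginal `ν₁` and second marginal `ν₂`. -/
def transportCost [MeasurableSpace X] (c : X × X → ℝ≥0) (ν₁ ν₂ : Measure X) : ℝ≥0∞ :=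
  ⨅ (π : Measure (X × X)) (_ : IsProbabilityMeasure π) (_ : π.fst = ν₁) (_ : π.snd = ν₂),
    ∫⁻ p, (c p : ℝ≥0∞) ∂π

/-- `Q_c f (x) = inf_y {f y + c (x, y)}`. It is used for bounded `f` on a nonempty space, where the
infimum is over a nonempty set of reals that is bounded below. -/
def infConvolution (c : X × X → ℝ≥0) (f : X → ℝ) (x : X) : ℝ :=
  ⨅ y, (f y + (c (x, y) : ℝ))

/-- Property (τ) for the couple `(μ, c)`: `∫ e^{Q_c f} dμ · ∫ e^{-f} dμ ≤ 1` for all bounded Borel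
functions `f`. Both integrals are integrals of nonnegative functions, with values in `[0, ∞]`.
When `X` is Polish and `c` and `f` are Borel, each set `{Q_c f < t}` is the projection of a Borel
set, so that `Q_c f` is universally measurable and its exponential agrees `μ`-almost everywhere
with a Borel function; the first integral is the usual one (against the completion of `μ`). -/
def PropertyTau [MeasurableSpace X] (μ : Measure X) (c : X × X → ℝ≥0) : Prop :=
  ∀ f : X → ℝ, Measurable f → (∃ C : ℝ, ∀ x, |f x| ≤ C) →
    (∫⁻ x, ENNReal.ofReal (Real.exp (infConvolution c f x)) ∂μ) *
      (∫⁻ x, ENNReal.ofReal (Real.exp (-f x)) ∂μ) ≤ 1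

end TransportEntropy

end

/-!
Kantorovich duality turns `T_c(ν₁, ν₂) ≤ H(ν₁|μ) + H(ν₂|μ)` into the family of inequalities
`∫ g dν₁ + ∫ f dν₂ ≤ H(ν₁|μ) + H(ν₂|μ)` over all bounded `g`, `f` with `g x + f y ≤ c (x, y)`.
For fixed `g` and `f`, the Gibbs variational principle `∫ g dν ≤ H(ν|μ) + log ∫ e^g dμ`, with
equality at `dν ∝ e^g dμ`, shows that these inequalities hold for all `ν₁`, `ν₂` exactly when
`log ∫ e^g dμ + log ∫ e^f dμ ≤ 0`. For fixed `f`, the largest admissible `g` is `Q_c (-f)`, so this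
is Property (τ) for `-f`.

The nontrivial half of the duality is a moment problem: a coupling of `ν₁` and `ν₂` of cost at most
`M` is a positive functional on continuous functions of two variables with prescribed values on the
sums `g x + f y`, bounded by `M` on the continuous minorants of `c`. The Riesz extension theorem
provides such a functional on the square of a compactification (the Hilbert cube), the
Riesz–Markov–Kakutani theorem makes it a measure, and this measure lives on the image of `X × X`
because its marginals do.
-/

namespace TransportEntropy

section Separation

open scoped Pointwise

theorem nonneg_of_forall_le_nsmul {G : Type*} [AddCommGroup G] [LinearOrder G]
    [IsOrderedAddMonoid G] [Archimedean G] {a b : G} (h : ∀ n : ℕ, b ≤ n • a) : 0 ≤ a := by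
  by_contra! ha
  obtain ⟨n, hn⟩ := exists_lt_nsmul (neg_pos.mpr ha) (-b)
  rw [smul_neg, neg_lt_neg_iff] at hn
  exact (h n).not_gt hn

variable {V E : Type*} [AddCommGroup V] [Module ℝ V] [AddCommGroup E] [Module ℝ E]

/-- The cone of triples `(v, a, w)` with `0 ≤ a` and `v + a • u = T w` for some `u ∈ K`. A linear
functional `Λ` satisfies `Λ (T w) = ℓ w` for all `w` and `Λ ≤ M` on `K` exactly when
`Λ v + a * M - ℓ w` is nonnegative on this cone, so that these constraints on `Λ` become the
positivity required by the Riesz extension theorem. -/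
def constraintCone {K : Set V} (hK : Convex ℝ K) (hne : K.Nonempty) (T : E →ₗ[ℝ] V) :
    PointedCone ℝ (V × ℝ × E) where
  carrier := {p | 0 ≤ p.2.1 ∧ T p.2.2 - p.1 ∈ p.2.1 • K}
  zero_mem' := by simp [Set.zero_smul_set hne]
  add_mem' := by
    rintro ⟨v₁, a₁, w₁⟩ ⟨v₂, a₂, w₂⟩ ⟨h₁, m₁⟩ ⟨h₂, m₂⟩
    refine ⟨add_nonneg h₁ h₂, ?_⟩
    simpa only [Prod.mk_add_mk, map_add, add_sub_add_comm, hK.add_smul h₁ h₂]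
      using Set.add_mem_add m₁ m₂
  smul_mem' := by
    rintro ⟨r, hr⟩ ⟨v, a, w⟩ ⟨ha, hm⟩
    refine ⟨mul_nonneg hr ha, ?_⟩
    simpa [smul_smul, smul_sub] using Set.smul_mem_smul_set (a := r) hm

theorem nonneg_of_mem_constraintCone {K : Set V} (hK : Convex ℝ K) (hne : K.Nonempty)
    (T : E →ₗ[ℝ] V) (hT : (T ⁻¹' K).Nonempty) (ℓ : E →ₗ[ℝ] ℝ) {M : ℝ}
    (hℓ : ∀ w, T w ∈ K → ℓ w ≤ M) {a : ℝ} {w : E} (hw : (0, a, w) ∈ constraintCone hK hne T) :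
    0 ≤ a * M - ℓ w := by
  obtain ⟨ha : 0 ≤ a, u, hu, huw : a • u = T w - 0⟩ := hw
  rw [sub_zero] at huw
  obtain rfl | ha := ha.eq_or_lt
  · obtain ⟨w₀, hw₀⟩ := hT
    have hTw : T w = 0 := by rw [← huw, zero_smul]
    rw [zero_mul, zero_sub]
    refine nonneg_of_forall_le_nsmul (b := ℓ w₀ - M) fun n => ?_
    have := hℓ (w₀ + n • w) (by simpa [hTw] using hw₀)
    rw [map_add, map_nsmul] at this
    rw [smul_neg]
    linarith
  · have := hℓ (a⁻¹ • w) (by rwa [map_smul, ← huw, inv_smul_smul₀ ha.ne'])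
    rw [map_smul, smul_eq_mul, inv_mul_le_iff₀ ha] at this
    linarith

theorem exists_linearMap_le_on_convex {K : Set V} (hK : Convex ℝ K) (T : E →ₗ[ℝ] V)
    (hT : ∀ v, ∃ w, T w + v ∈ K) (ℓ : E →ₗ[ℝ] ℝ) {M : ℝ} (hℓ : ∀ w, T w ∈ K → ℓ w ≤ M) :
    ∃ Λ : V →ₗ[ℝ] ℝ, (∀ w, Λ (T w) = ℓ w) ∧ ∀ u ∈ K, Λ u ≤ M := by
  obtain ⟨w₀, hw₀⟩ : ∃ w, T w ∈ K := by simpa using hT 0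
  let φ : V × ℝ × E →ₗ[ℝ] ℝ :=
    ((LinearMap.toSpanSingleton ℝ ℝ M).coprod (-ℓ)).comp (LinearMap.snd ℝ V (ℝ × E))
  obtain ⟨Φ, hΦ, hpos⟩ := riesz_extension (constraintCone hK ⟨_, hw₀⟩ T)
    ⟨LinearMap.ker (LinearMap.fst ℝ V (ℝ × E)), φ.domRestrict _⟩
    (by
      rintro ⟨⟨v, a, w⟩, rfl : v = 0⟩ hw
      simpa [φ, sub_eq_add_neg] using nonneg_of_mem_constraintCone hK _ T ⟨w₀, hw₀⟩ ℓ hℓ hw)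
    (by
      rintro ⟨v, b, w⟩
      obtain ⟨w', hw'⟩ := hT (-v)
      refine ⟨⟨(0, 1 - b, w' - w), rfl⟩, by simp, _, hw', ?_⟩
      simp [sub_eq_add_neg])
  let Λ : V →ₗ[ℝ] ℝ := Φ.comp (LinearMap.inl ℝ V (ℝ × E))
  have hsplit : ∀ v a w, Φ (v, a, w) = Λ v + (a * M + -ℓ w) := fun v a w => by
    rw [← show Φ (0, a, w) = a * M + -ℓ w from hΦ ⟨(0, a, w), rfl⟩]
    simp [Λ, ← map_add]
  have hgraph : ∀ w, ℓ w ≤ Λ (T w) := fun w => by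
    have := hpos (T w, 0, w) ⟨le_rfl, by simp [Set.zero_smul_set ⟨_, hw₀⟩]⟩
    rw [hsplit] at this
    linarith
  refine ⟨Λ, fun w => le_antisymm (by simpa using hgraph (-w)) (hgraph w), fun u hu => ?_⟩
  have := hpos (-u, 1, 0) ⟨zero_le_one, u, hu, by simp⟩
  rw [hsplit, map_neg, map_zero] at this
  linarith

end Separation

section Compact

open TopologicalSpace

theorem exists_isFiniteMeasure_integral_eq {Z : Type*} [TopologicalSpace Z] [CompactSpace Z]
    [T2Space Z] [MeasurableSpace Z] [BorelSpace Z] (Λ : C(Z, ℝ) →ₗ[ℝ] ℝ)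
    (hΛ : ∀ u, 0 ≤ u → 0 ≤ Λ u) :
    ∃ π : Measure Z, IsFiniteMeasure π ∧ ∀ u : C(Z, ℝ), ∫ z, u z ∂π = Λ u := by
  let Λc : CompactlySupportedContinuousMap Z ℝ →ₚ[ℝ] ℝ := PositiveLinearMap.mk₀
    { toFun := fun u => Λ u
      map_add' := fun u v => map_add Λ (u : C(Z, ℝ)) v
      map_smul' := fun r u => map_smul Λ r (u : C(Z, ℝ)) }
    fun u hu => hΛ u hu
  exact ⟨RealRMK.rieszMeasure Λc, inferInstance, fun u =>
    RealRMK.integral_rieszMeasure Λc ⟨u, HasCompactSupport.of_compactSpace u⟩⟩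

theorem exists_measure_integral_le_on_convex {Z E : Type*} [TopologicalSpace Z] [CompactSpace Z]
    [T2Space Z] [MeasurableSpace Z] [BorelSpace Z] [AddCommGroup E] [Module ℝ E]
    {K : Set C(Z, ℝ)} (hK : Convex ℝ K) (hlow : IsLowerSet K) (hne : K.Nonempty)
    (T : E →ₗ[ℝ] C(Z, ℝ)) (hT : 1 ∈ LinearMap.range T) (ℓ : E →ₗ[ℝ] ℝ) {M : ℝ}
    (hℓ : ∀ w, T w ∈ K → ℓ w ≤ M) :
    ∃ π : Measure Z, IsFiniteMeasure π ∧ (∀ w, ∫ z, T w z ∂π = ℓ w) ∧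
      ∀ u ∈ K, ∫ z, u z ∂π ≤ M := by
  obtain ⟨e, he⟩ := hT
  obtain ⟨u₀, hu₀⟩ := hne
  have habsorb : ∀ v, ∃ w, T w + v ∈ K := fun v => by
    refine ⟨-‖v - u₀‖ • e, hlow (fun z => ?_) hu₀⟩
    have hz : v z - u₀ z ≤ ‖v - u₀‖ := (le_abs_self _).trans ((v - u₀).norm_coe_le_norm z)
    rw [map_smul, he]
    change -‖v - u₀‖ * 1 + v z ≤ u₀ z
    linarith
  obtain ⟨Λ, hΛT, hΛK⟩ := exists_linearMap_le_on_convex hK T habsorb ℓ hℓ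
  have hpos : ∀ u, 0 ≤ u → 0 ≤ Λ u := fun u hu =>
    nonneg_of_forall_le_nsmul (b := Λ u₀ - M) fun n => by
      have hmem : u₀ - n • u ∈ K := hlow (sub_le_self u₀ (nsmul_nonneg hu n)) hu₀
      have := hΛK _ hmem
      rw [map_sub, map_nsmul] at this
      linarith
  obtain ⟨π, hπ, hΛ⟩ := exists_isFiniteMeasure_integral_eq Λ hpos
  exact ⟨π, hπ, fun w => by rw [hΛ, hΛT], fun u hu => by rw [hΛ]; exact hΛK u hu⟩

/-- Integration of continuous functions against a finite measure on a compact space, as a linear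
functional. -/
noncomputable def integralFunctional {Y : Type*} [TopologicalSpace Y] [CompactSpace Y]
    [MeasurableSpace Y] [BorelSpace Y] (ν : Measure Y) [IsFiniteMeasure ν] :
    C(Y, ℝ) →ₗ[ℝ] ℝ where
  toFun g := ∫ y, g y ∂ν
  map_add' g g' := integral_add
    ((BoundedContinuousFunction.mkOfCompact g).integrable ν)
    ((BoundedContinuousFunction.mkOfCompact g').integrable ν)
  map_smul' r g := integral_smul r g

variable {Y₁ Y₂ : Type*} [TopologicalSpace Y₁] [TopologicalSpace Y₂]

/-- The function `g ⊕ f : (x, y) ↦ g x + f y` attached to a pair `(g, f)` of potentials, as a linear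
map of the pair. -/
def tensorSum : C(Y₁, ℝ) × C(Y₂, ℝ) →ₗ[ℝ] C(Y₁ × Y₂, ℝ) :=
  (ContinuousMap.compRightAlgHom ℝ ℝ ContinuousMap.fst).toLinearMap.coprod
    (ContinuousMap.compRightAlgHom ℝ ℝ ContinuousMap.snd).toLinearMap

theorem tensorSum_apply (w : C(Y₁, ℝ) × C(Y₂, ℝ)) (p : Y₁ × Y₂) :
    tensorSum w p = w.1 p.1 + w.2 p.2 := rfl

theorem exists_coupling_of_isLowerSet [CompactSpace Y₁] [MetrizableSpace Y₁]
    [SecondCountableTopology Y₁] [MeasurableSpace Y₁] [BorelSpace Y₁] [CompactSpace Y₂]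
    [MetrizableSpace Y₂] [MeasurableSpace Y₂] [BorelSpace Y₂]
    {ν₁ : Measure Y₁} [IsProbabilityMeasure ν₁] {ν₂ : Measure Y₂} [IsProbabilityMeasure ν₂]
    {K : Set C(Y₁ × Y₂, ℝ)} (hK : Convex ℝ K) (hlow : IsLowerSet K) (hne : K.Nonempty) {M : ℝ}
    (hM : ∀ (g : C(Y₁, ℝ)) (f : C(Y₂, ℝ)), tensorSum (g, f) ∈ K →
      ∫ x, g x ∂ν₁ + ∫ y, f y ∂ν₂ ≤ M) :
    ∃ π : Measure (Y₁ × Y₂), IsProbabilityMeasure π ∧ π.fst = ν₁ ∧ π.snd = ν₂ ∧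
      ∀ u ∈ K, ∫ p, u p ∂π ≤ M := by
  have hone : (tensorSum (1, 0) : C(Y₁ × Y₂, ℝ)) = 1 := by ext p; simp [tensorSum_apply]
  obtain ⟨π, hπ, hmarg, hle⟩ := exists_measure_integral_le_on_convex hK hlow hne tensorSum
    ⟨_, hone⟩ ((integralFunctional ν₁).coprod (integralFunctional ν₂)) fun w => hM w.1 w.2
  have hfst : π.fst = ν₁ := ext_of_forall_integral_eq_of_IsFiniteMeasure fun g => by
    rw [Measure.fst, integral_map (by fun_prop) g.continuous.aestronglyMeasurable]
    simpa [tensorSum_apply, integralFunctional] using hmarg (g.toContinuousMap, 0)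
  have hsnd : π.snd = ν₂ := ext_of_forall_integral_eq_of_IsFiniteMeasure fun f => by
    rw [Measure.snd, integral_map (by fun_prop) f.continuous.aestronglyMeasurable]
    simpa [tensorSum_apply, integralFunctional] using hmarg (0, f.toContinuousMap)
  refine ⟨π, ⟨?_⟩, hfst, hsnd, hle⟩
  rw [← Measure.fst_univ, hfst, measure_univ]

end Compact

section LowerSemicontinuous

open Filter Topology

variable {X Y : Type*} [PseudoMetricSpace Y] {c : X → ℝ} {e : X → Y} {b : ℝ}

/-- The largest `n`-Lipschitz function on `Y` whose pullback by `e` is at most `c`, that is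
`y ↦ inf_x (c x + n * dist y (e x))`. It is used for `c` bounded below on a nonempty `X`, where the
infimum is not a junk value. -/
noncomputable def lipschitzEnvelope (c : X → ℝ) (e : X → Y) (n : ℕ) (y : Y) : ℝ :=
  ⨅ x, (c x + n * dist y (e x))

theorem bddBelow_range_lipschitzEnvelope (hb : ∀ x, b ≤ c x) (n : ℕ) (y : Y) :
    BddBelow (Set.range fun x => c x + n * dist y (e x)) :=
  ⟨b, by rintro _ ⟨x, rfl⟩; exact le_add_of_le_of_nonneg (hb x) (by positivity)⟩

theorem lipschitzEnvelope_le (hb : ∀ x, b ≤ c x) (n : ℕ) (x : X) :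
    lipschitzEnvelope c e n (e x) ≤ c x :=
  (ciInf_le (bddBelow_range_lipschitzEnvelope hb n (e x)) x).trans (by simp)

theorem lipschitzEnvelope_mono (hb : ∀ x, b ≤ c x) {m n : ℕ} (hmn : m ≤ n) (y : Y) :
    lipschitzEnvelope c e m y ≤ lipschitzEnvelope c e n y :=
  ciInf_mono (bddBelow_range_lipschitzEnvelope hb m y) fun x => by gcongr

variable [Nonempty X]

theorem le_lipschitzEnvelope (hb : ∀ x, b ≤ c x) (n : ℕ) (y : Y) :
    b ≤ lipschitzEnvelope c e n y :=
  le_ciInf fun x => le_add_of_le_of_nonneg (hb x) (by positivity)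

theorem lipschitzWith_lipschitzEnvelope (hb : ∀ x, b ≤ c x) (n : ℕ) :
    LipschitzWith n (lipschitzEnvelope c e n) :=
  LipschitzWith.of_le_add_mul _ fun y y' => by
    rw [lipschitzEnvelope, lipschitzEnvelope, ciInf_add (bddBelow_range_lipschitzEnvelope hb n y')]
    refine le_ciInf fun x => (ciInf_le (bddBelow_range_lipschitzEnvelope hb n y) x).trans ?_
    have := mul_le_mul_of_nonneg_left (dist_triangle y y' (e x)) n.cast_nonneg (α := ℝ)
    simp only [NNReal.coe_natCast]
    linarith

theorem tendsto_lipschitzEnvelope [TopologicalSpace X] (he : IsInducing e)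
    (hc : LowerSemicontinuous c) (hb : ∀ x, b ≤ c x) (x : X) :
    Tendsto (fun n => lipschitzEnvelope c e n (e x)) atTop (𝓝 (c x)) := by
  refine tendsto_order.mpr ⟨fun t ht => ?_, fun t ht =>
    Eventually.of_forall fun n => (lipschitzEnvelope_le hb n x).trans_lt ht⟩
  obtain ⟨s, hts, hsc⟩ := exists_between ht
  obtain ⟨δ, hδ, hball⟩ : ∃ δ > 0, ∀ x', dist (e x) (e x') < δ → s < c x' := by
    have := hc x s hsc
    rw [he.nhds_eq_comap, Filter.Eventually, (Metric.nhds_basis_ball.comap e).mem_iff] at this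
    obtain ⟨δ, hδ, h⟩ := this
    exact ⟨δ, hδ, fun x' hx' => h (by rwa [Set.mem_preimage, Metric.mem_ball'])⟩
  filter_upwards [eventually_ge_atTop ⌈(s - b) / δ⌉₊] with n hn
  have hn : s - b ≤ n * δ := (div_le_iff₀ hδ).mp (Nat.ceil_le.mp hn)
  refine hts.trans_le (le_ciInf fun x' => ?_)
  obtain hx' | hx' := lt_or_ge (dist (e x) (e x')) δ
  · exact le_add_of_le_of_nonneg (hball x' hx').le (by positivity)
  · have := mul_le_mul_of_nonneg_left hx' n.cast_nonneg (α := ℝ)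
    linarith [hb x']

end LowerSemicontinuous

section Duality

open Filter Topology TopologicalSpace

variable {X : Type*} [MeasurableSpace X]

theorem ofReal_integral_le_lintegral_ofReal {μ : Measure X} {f : X → ℝ} (hf : Integrable f μ) :
    ENNReal.ofReal (∫ x, f x ∂μ) ≤ ∫⁻ x, ENNReal.ofReal (f x) ∂μ := by
  rw [integral_eq_lintegral_pos_part_sub_lintegral_neg_part hf]
  exact (ENNReal.ofReal_le_ofReal (sub_le_self _ ENNReal.toReal_nonneg)).trans
    ENNReal.ofReal_toReal_le

theorem ofReal_integral_add_le_transportCost {c : X × X → ℝ≥0} {ν₁ ν₂ : Measure X} {g f : X → ℝ}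
    (hg : Integrable g ν₁) (hf : Integrable f ν₂) (h : ∀ x y, g x + f y ≤ c (x, y)) :
    ENNReal.ofReal (∫ x, g x ∂ν₁ + ∫ y, f y ∂ν₂) ≤ transportCost c ν₁ ν₂ := by
  simp only [transportCost, le_iInf_iff]
  rintro π _ rfl rfl
  have hg' : Integrable (fun p => g p.1) π := hg.comp_measurable measurable_fst
  have hf' : Integrable (fun p => f p.2) π := hf.comp_measurable measurable_snd
  calc ENNReal.ofReal (∫ x, g x ∂π.fst + ∫ y, f y ∂π.snd)
      = ENNReal.ofReal (∫ p, (g p.1 + f p.2) ∂π) := by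
        rw [integral_add hg' hf', Measure.fst, Measure.snd,
          integral_map measurable_fst.aemeasurable hg.aestronglyMeasurable,
          integral_map measurable_snd.aemeasurable hf.aestronglyMeasurable]
    _ ≤ ∫⁻ p, ENNReal.ofReal (g p.1 + f p.2) ∂π :=
        ofReal_integral_le_lintegral_ofReal (hg'.add hf')
    _ ≤ ∫⁻ p, (c p : ℝ≥0∞) ∂π := lintegral_mono fun p =>
        ENNReal.ofReal_le_of_le_toReal (h p.1 p.2)

theorem exists_measurable_retraction {Y : Type*} [MeasurableSpace Y] [Nonempty X] {e : X → Y}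
    (he : MeasurableEmbedding e) (ν : Measure X) :
    ∃ r : Y → X, Measurable r ∧ r ∘ e = id ∧ ∀ᵐ y ∂ν.map e, e (r y) = y := by
  obtain ⟨r, hr, hre⟩ := he.exists_measurable_extend measurable_id fun _ => inferInstance
  refine ⟨r, hr, hre, he.ae_map_iff.mpr (.of_forall fun x => ?_)⟩
  exact congrArg e (congrFun hre x)

theorem exists_coupling_map_prodMap_eq {X₁ X₂ Y₁ Y₂ : Type*} [MeasurableSpace X₁]
    [MeasurableSpace X₂] [MeasurableSpace Y₁] [MeasurableSpace Y₂] [Nonempty X₁] [Nonempty X₂]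
    {e₁ : X₁ → Y₁} {e₂ : X₂ → Y₂} (he₁ : MeasurableEmbedding e₁) (he₂ : MeasurableEmbedding e₂)
    {ν₁ : Measure X₁} {ν₂ : Measure X₂} {ρ : Measure (Y₁ × Y₂)}
    (h₁ : ρ.fst = ν₁.map e₁) (h₂ : ρ.snd = ν₂.map e₂) :
    ∃ π : Measure (X₁ × X₂), π.fst = ν₁ ∧ π.snd = ν₂ ∧ π.map (Prod.map e₁ e₂) = ρ := by
  obtain ⟨r₁, hr₁, hre₁, hae₁⟩ := exists_measurable_retraction he₁ ν₁
  obtain ⟨r₂, hr₂, hre₂, hae₂⟩ := exists_measurable_retraction he₂ ν₂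
  rw [← h₁] at hae₁
  rw [← h₂] at hae₂
  refine ⟨ρ.map (Prod.map r₁ r₂), ?_, ?_, ?_⟩
  · calc (ρ.map (Prod.map r₁ r₂)).fst = ρ.fst.map r₁ := by
          rw [Measure.fst, Measure.fst, Measure.map_map measurable_fst (hr₁.prodMap hr₂),
            Measure.map_map hr₁ measurable_fst, Prod.map_fst']
      _ = ν₁ := by rw [h₁, Measure.map_map hr₁ he₁.measurable, hre₁, Measure.map_id]
  · calc (ρ.map (Prod.map r₁ r₂)).snd = ρ.snd.map r₂ := by
          rw [Measure.snd, Measure.snd, Measure.map_map measurable_snd (hr₁.prodMap hr₂),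
            Measure.map_map hr₂ measurable_snd, Prod.map_snd']
      _ = ν₂ := by rw [h₂, Measure.map_map hr₂ he₂.measurable, hre₂, Measure.map_id]
  · rw [Measure.map_map (he₁.measurable.prodMap he₂.measurable) (hr₁.prodMap hr₂)]
    refine (Measure.map_congr ?_).trans Measure.map_id
    filter_upwards [ae_of_ae_map measurable_fst.aemeasurable hae₁,
      ae_of_ae_map measurable_snd.aemeasurable hae₂] with p hp₁ hp₂
    exact Prod.ext hp₁ hp₂

theorem transportCost_le_lintegral {c : X × X → ℝ≥0} {ν₁ ν₂ : Measure X} {π : Measure (X × X)}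
    [IsProbabilityMeasure π] (h₁ : π.fst = ν₁) (h₂ : π.snd = ν₂) :
    transportCost c ν₁ ν₂ ≤ ∫⁻ p, (c p : ℝ≥0∞) ∂π :=
  iInf₂_le_of_le π inferInstance (iInf₂_le h₁ h₂)

theorem lintegral_le_of_forall_integral_le_of_isInducing {Z Y : Type*} [TopologicalSpace Z]
    [MeasurableSpace Z] [OpensMeasurableSpace Z] [TopologicalSpace Y] [PseudoMetrizableSpace Y]
    [CompactSpace Y] {e : Z → Y} (he : IsInducing e) {c : Z → ℝ≥0} (hc : LowerSemicontinuous c)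
    {π : Measure Z} [IsFiniteMeasure π] {M : ℝ}
    (h : ∀ u : C(Y, ℝ), (∀ z, u (e z) ≤ c z) → ∫ z, u (e z) ∂π ≤ M) :
    ∫⁻ z, (c z : ℝ≥0∞) ∂π ≤ ENNReal.ofReal M := by
  let := pseudoMetrizableSpacePseudoMetric Y
  obtain _ | _ := isEmpty_or_nonempty Z
  · simp [lintegral_of_isEmpty]
  have hc' : LowerSemicontinuous fun z => (c z : ℝ) :=
    NNReal.continuous_coe.comp_lowerSemicontinuous hc NNReal.coe_mono
  have hc₀ : ∀ z, (0 : ℝ) ≤ c z := fun z => (c z).coe_nonneg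
  let d (n : ℕ) : C(Y, ℝ) := ⟨_, (lipschitzWith_lipschitzEnvelope (e := e) hc₀ n).continuous⟩
  have hd : ∀ n, Continuous fun z => d n (e z) := fun n => (d n).continuous.comp he.continuous
  have hd₀ : ∀ n y, 0 ≤ d n y := le_lipschitzEnvelope hc₀
  have hlim : Tendsto (fun n => ∫⁻ z, ENNReal.ofReal (d n (e z)) ∂π) atTop
      (𝓝 (∫⁻ z, (c z : ℝ≥0∞) ∂π)) := by
    refine lintegral_tendsto_of_tendsto_of_monotone
      (fun n => (hd n).measurable.ennreal_ofReal.aemeasurable)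
      (Eventually.of_forall fun z m n hmn =>
        ENNReal.ofReal_le_ofReal (lipschitzEnvelope_mono hc₀ hmn (e z)))
      (Eventually.of_forall fun z => ?_)
    rw [← ENNReal.ofReal_coe_nnreal]
    exact ENNReal.tendsto_ofReal (tendsto_lipschitzEnvelope he hc' hc₀ z)
  refine le_of_tendsto' hlim fun n => ?_
  have hint : Integrable (fun z => d n (e z)) π :=
    (BoundedContinuousFunction.mkOfCompact (d n)).compContinuous ⟨e, he.continuous⟩ |>.integrable π
  rw [← ofReal_integral_eq_lintegral_ofReal hint (Eventually.of_forall fun z => hd₀ n (e z))]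
  exact ENNReal.ofReal_le_ofReal (h (d n) (lipschitzEnvelope_le hc₀ n))

theorem transportCost_le_of_forall_integral_add_le [TopologicalSpace X] [MetrizableSpace X]
    [SecondCountableTopology X] [BorelSpace X] [StandardBorelSpace X] {c : X × X → ℝ≥0}
    (hc : LowerSemicontinuous c) {ν₁ ν₂ : Measure X} [IsProbabilityMeasure ν₁]
    [IsProbabilityMeasure ν₂] {M : ℝ}
    (h : ∀ g f : BoundedContinuousFunction X ℝ, (∀ x y, g x + f y ≤ c (x, y)) →
      ∫ x, g x ∂ν₁ + ∫ y, f y ∂ν₂ ≤ M) :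
    transportCost c ν₁ ν₂ ≤ ENNReal.ofReal M := by
  let := metrizableSpaceMetric X
  have : Nonempty X := nonempty_of_isProbabilityMeasure ν₁
  obtain ⟨e, he⟩ := Metric.PiNatEmbed.exists_embedding_to_hilbert_cube (X := X)
  have hme : MeasurableEmbedding e := he.continuous.measurable.measurableEmbedding he.injective
  let K : Set C((ℕ → unitInterval) × (ℕ → unitInterval), ℝ) :=
    {u | ∀ p, u (Prod.map e e p) ≤ c p}
  have hK : Convex ℝ K := fun u hu v hv a b ha hb hab p => by
    calc a * u (Prod.map e e p) + b * v (Prod.map e e p)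
        ≤ a * c p + b * c p := by gcongr; exacts [hu p, hv p]
      _ = c p := by rw [← add_mul, hab, one_mul]
  have hlow : IsLowerSet K := fun u v hvu hu p => (hvu _).trans (hu p)
  have := Measure.isProbabilityMeasure_map hme.measurable.aemeasurable (μ := ν₁)
  have := Measure.isProbabilityMeasure_map hme.measurable.aemeasurable (μ := ν₂)
  obtain ⟨ρ, hρ, hρ₁, hρ₂, hρK⟩ := exists_coupling_of_isLowerSet (ν₁ := ν₁.map e)
    (ν₂ := ν₂.map e) hK hlow ⟨0, fun p => by simp⟩ (M := M) fun g f hgf => by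
      rw [hme.integral_map, hme.integral_map]
      exact h (.compContinuous (.mkOfCompact g) ⟨e, he.continuous⟩)
        (.compContinuous (.mkOfCompact f) ⟨e, he.continuous⟩) fun x y => hgf (x, y)
  obtain ⟨π, hπ₁, hπ₂, rfl⟩ := exists_coupling_map_prodMap_eq hme hme hρ₁ hρ₂
  have : IsProbabilityMeasure π := ⟨by rw [← Measure.fst_univ, hπ₁, measure_univ]⟩
  refine (transportCost_le_lintegral hπ₁ hπ₂).trans <|
    lintegral_le_of_forall_integral_le_of_isInducing (he.isInducing.prodMap he.isInducing) hc
      fun u hu => ?_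
  have := hρK u hu
  rwa [(hme.prodMap hme).integral_map] at this

end Duality

section Gibbs

open InformationTheory

variable {X : Type*} [MeasurableSpace X] {μ ν : Measure X} {g : X → ℝ}

theorem integral_le_toReal_klDiv_add_log_integral_exp [IsProbabilityMeasure μ]
    [IsProbabilityMeasure ν] (hkl : klDiv ν μ ≠ ∞) (hg : Integrable g ν)
    (hexp : Integrable (fun x => Real.exp (g x)) μ) :
    ∫ x, g x ∂ν ≤ (klDiv ν μ).toReal + Real.log (∫ x, Real.exp (g x) ∂μ) := by
  obtain ⟨hac, hint⟩ := klDiv_ne_top_iff.1 hkl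
  have := isProbabilityMeasure_tilted hexp
  have hgibbs : 0 ≤ ∫ x, llr ν (μ.tilted g) x ∂ν := by
    simpa using integral_llr_add_sub_measure_univ_nonneg
      (hac.trans (absolutelyContinuous_tilted hexp))
      (integrable_llr_tilted_right hac hg hint hexp)
  rw [integral_llr_tilted_right hac hg hexp hint] at hgibbs
  rw [toReal_klDiv_of_measure_eq hac (by simp)]
  linarith

theorem llr_tilted_left_ae_eq [SigmaFinite μ] (hexp : Integrable (fun x => Real.exp (g x)) μ) :
    llr (μ.tilted g) μ =ᵐ[μ.tilted g] fun x => g x - Real.log (∫ x, Real.exp (g x) ∂μ) :=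
  (tilted_absolutelyContinuous μ g).ae_le (log_rnDeriv_tilted_left_self hexp)

theorem klDiv_tilted_ne_top [IsFiniteMeasure μ] (hexp : Integrable (fun x => Real.exp (g x)) μ)
    (hg : Integrable g (μ.tilted g)) : klDiv (μ.tilted g) μ ≠ ∞ :=
  klDiv_ne_top (tilted_absolutelyContinuous μ g)
    ((hg.sub (integrable_const _)).congr (llr_tilted_left_ae_eq hexp).symm)

theorem toReal_klDiv_tilted [IsProbabilityMeasure μ]
    (hexp : Integrable (fun x => Real.exp (g x)) μ) (hg : Integrable g (μ.tilted g)) :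
    (klDiv (μ.tilted g) μ).toReal =
      ∫ x, g x ∂(μ.tilted g) - Real.log (∫ x, Real.exp (g x) ∂μ) := by
  have := isProbabilityMeasure_tilted hexp
  rw [toReal_klDiv_of_measure_eq (tilted_absolutelyContinuous μ g) (by simp),
    integral_congr_ae (llr_tilted_left_ae_eq hexp), integral_sub hg (integrable_const _)]
  simp

end Gibbs

section PropertyTau

theorem infConvolution_le {X : Type*} {c : X × X → ℝ≥0} {f : X → ℝ} {b : ℝ}
    (hb : ∀ y, b ≤ f y) (x y : X) :
    infConvolution c f x ≤ f y + c (x, y) :=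
  ciInf_le ⟨b, by rintro _ ⟨y, rfl⟩; exact le_add_of_le_of_nonneg (hb y) (c _).coe_nonneg⟩ y

open InformationTheory

variable {X : Type*} [MeasurableSpace X] {μ : Measure X} {c : X × X → ℝ≥0} {f g : X → ℝ}

theorem integrable_exp_of_bounded [IsFiniteMeasure μ] (hg : Measurable g)
    (hbdd : ∃ C, ∀ x, |g x| ≤ C) : Integrable (fun x => Real.exp (g x)) μ := by
  obtain ⟨C, hC⟩ := hbdd
  refine .of_bound hg.exp.aestronglyMeasurable (Real.exp C) (.of_forall fun x => ?_)
  rw [Real.norm_eq_abs, Real.abs_exp]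
  exact Real.exp_le_exp.mpr ((le_abs_self _).trans (hC x))

theorem integrable_of_bounded [IsFiniteMeasure μ] (hg : Measurable g)
    (hbdd : ∃ C, ∀ x, |g x| ≤ C) : Integrable g μ :=
  hbdd.elim fun C hC => .of_bound hg.aestronglyMeasurable C (Filter.Eventually.of_forall hC)

theorem lintegral_exp_mul_lintegral_exp_le_one_iff [NeZero μ]
    (hg : Integrable (fun x => Real.exp (g x)) μ) (hf : Integrable (fun x => Real.exp (f x)) μ) :
    (∫⁻ x, ENNReal.ofReal (Real.exp (g x)) ∂μ) * (∫⁻ x, ENNReal.ofReal (Real.exp (f x)) ∂μ) ≤ 1 ↔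
      Real.log (∫ x, Real.exp (g x) ∂μ) + Real.log (∫ x, Real.exp (f x) ∂μ) ≤ 0 := by
  have hg₀ := integral_exp_pos hg
  have hf₀ := integral_exp_pos hf
  rw [← ofReal_integral_eq_lintegral_ofReal hg (.of_forall fun x => (Real.exp_pos _).le),
    ← ofReal_integral_eq_lintegral_ofReal hf (.of_forall fun x => (Real.exp_pos _).le),
    ← ENNReal.ofReal_mul hg₀.le, ENNReal.ofReal_le_one, ← Real.log_mul hg₀.ne' hf₀.ne',
    Real.log_nonpos_iff (mul_pos hg₀ hf₀).le]

theorem lintegral_exp_le_of_forall_simpleFunc_le {F : X → ℝ} {b : ℝ} (hb : ∀ x, b ≤ F x)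
    {B : ℝ≥0∞} (h : ∀ φ : SimpleFunc X ℝ, (∀ x, φ x ≤ F x) →
      ∫⁻ x, ENNReal.ofReal (Real.exp (φ x)) ∂μ ≤ B) :
    ∫⁻ x, ENNReal.ofReal (Real.exp (F x)) ∂μ ≤ B := by
  rw [lintegral_eq_nnreal]
  refine iSup₂_le fun ψ hψ => ?_
  let φ : SimpleFunc X ℝ := ψ.map fun r : ℝ≥0 => Real.log (max (r : ℝ) (Real.exp b))
  have hexp : ∀ x, Real.exp (φ x) = max (ψ x : ℝ) (Real.exp b) := fun x =>
    Real.exp_log (lt_max_of_lt_right (Real.exp_pos b))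
  have hφF : ∀ x, φ x ≤ F x := fun x => by
    rw [← Real.exp_le_exp, hexp]
    refine max_le ?_ (Real.exp_le_exp.mpr (hb x))
    simpa [ENNReal.ofReal, ENNReal.coe_le_coe, ← NNReal.coe_le_coe, Real.exp_nonneg] using hψ x
  calc (ψ.map (↑)).lintegral μ = ∫⁻ x, (ψ x : ℝ≥0∞) ∂μ := by
        rw [← SimpleFunc.lintegral_eq_lintegral]; rfl
    _ ≤ ∫⁻ x, ENNReal.ofReal (Real.exp (φ x)) ∂μ := lintegral_mono fun x => by
        rw [hexp, ← ENNReal.ofReal_coe_nnreal]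
        exact ENNReal.ofReal_le_ofReal (le_max_left _ _)
    _ ≤ B := h φ hφF

theorem propertyTau_iff_log_integral_exp_add_nonpos [IsFiniteMeasure μ] [NeZero μ] :
    PropertyTau μ c ↔ ∀ g f : X → ℝ, Measurable g → (∃ C, ∀ x, |g x| ≤ C) → Measurable f →
      (∃ C, ∀ x, |f x| ≤ C) → (∀ x y, g x + f y ≤ c (x, y)) →
      Real.log (∫ x, Real.exp (g x) ∂μ) + Real.log (∫ x, Real.exp (f x) ∂μ) ≤ 0 := by
  have : Nonempty X := μ.nonempty_of_neZero
  constructor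
  · rintro hτ g f hg hgb hf hfb hgf
    rw [← lintegral_exp_mul_lintegral_exp_le_one_iff (integrable_exp_of_bounded hg hgb)
      (integrable_exp_of_bounded hf hfb)]
    refine le_trans ?_ (hτ (-f) hf.neg (by simpa using hfb))
    gcongr with x x
    · exact le_ciInf fun y => by rw [Pi.neg_apply]; linarith [hgf x y]
    · simp
  · rintro h f hf ⟨C, hC⟩
    have hf' : Measurable fun x => -f x := hf.neg
    have hfb' : ∃ C, ∀ x, |-f x| ≤ C := ⟨C, by simpa using hC⟩
    have hlow : ∀ y, -C ≤ f y := fun y => neg_le_of_abs_le (hC y)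
    have hQ : ∀ x, -C ≤ infConvolution c f x := fun x =>
      le_ciInf fun y => le_add_of_le_of_nonneg (hlow y) (c _).coe_nonneg
    rw [← ENNReal.le_inv_iff_mul_le]
    refine lintegral_exp_le_of_forall_simpleFunc_le hQ fun φ hφ => ?_
    rw [ENNReal.le_inv_iff_mul_le, lintegral_exp_mul_lintegral_exp_le_one_iff
      (integrable_exp_of_bounded φ.measurable φ.exists_forall_norm_le)
      (integrable_exp_of_bounded hf' hfb')]
    refine h φ _ φ.measurable φ.exists_forall_norm_le hf' hfb' fun x y => ?_
    linarith [hφ x, infConvolution_le (c := c) hlow x y]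

theorem PropertyTau.integral_add_integral_le [IsProbabilityMeasure μ] (hτ : PropertyTau μ c)
    {ν₁ ν₂ : Measure X} [IsProbabilityMeasure ν₁] [IsProbabilityMeasure ν₂]
    (h₁ : klDiv ν₁ μ ≠ ∞) (h₂ : klDiv ν₂ μ ≠ ∞) (hg : Measurable g) (hgb : ∃ C, ∀ x, |g x| ≤ C)
    (hf : Measurable f) (hfb : ∃ C, ∀ x, |f x| ≤ C) (hgf : ∀ x y, g x + f y ≤ c (x, y)) :
    ∫ x, g x ∂ν₁ + ∫ x, f x ∂ν₂ ≤ (klDiv ν₁ μ + klDiv ν₂ μ).toReal := by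
  have hlog := propertyTau_iff_log_integral_exp_add_nonpos.mp hτ g f hg hgb hf hfb hgf
  rw [ENNReal.toReal_add h₁ h₂]
  linarith [integral_le_toReal_klDiv_add_log_integral_exp h₁ (integrable_of_bounded hg hgb)
      (integrable_exp_of_bounded hg hgb),
    integral_le_toReal_klDiv_add_log_integral_exp h₂ (integrable_of_bounded hf hfb)
      (integrable_exp_of_bounded hf hfb)]

theorem PropertyTau.transportCost_le [TopologicalSpace X] [TopologicalSpace.MetrizableSpace X]
    [SecondCountableTopology X] [BorelSpace X] [StandardBorelSpace X] [IsProbabilityMeasure μ]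
    (hτ : PropertyTau μ c) (hc : LowerSemicontinuous c) (ν₁ ν₂ : Measure X)
    [IsProbabilityMeasure ν₁] [IsProbabilityMeasure ν₂] :
    transportCost c ν₁ ν₂ ≤ klDiv ν₁ μ + klDiv ν₂ μ := by
  by_cases h₁ : klDiv ν₁ μ = ∞
  · simp [h₁]
  by_cases h₂ : klDiv ν₂ μ = ∞
  · simp [h₂]
  rw [← ENNReal.ofReal_toReal (ENNReal.add_ne_top.mpr ⟨h₁, h₂⟩)]
  exact transportCost_le_of_forall_integral_add_le hc fun g f hgf =>
    hτ.integral_add_integral_le h₁ h₂ g.continuous.measurable ⟨_, g.norm_coe_le_norm⟩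
      f.continuous.measurable ⟨_, f.norm_coe_le_norm⟩ hgf

theorem propertyTau_of_transportCost_le [IsProbabilityMeasure μ]
    (h : ∀ ν₁ ν₂ : Measure X, IsProbabilityMeasure ν₁ → IsProbabilityMeasure ν₂ →
      transportCost c ν₁ ν₂ ≤ klDiv ν₁ μ + klDiv ν₂ μ) :
    PropertyTau μ c := by
  rw [propertyTau_iff_log_integral_exp_add_nonpos]
  intro g f hg hgb hf hfb hgf
  have hgexp := integrable_exp_of_bounded (μ := μ) hg hgb
  have hfexp := integrable_exp_of_bounded (μ := μ) hf hfb
  have hgν := isProbabilityMeasure_tilted hgexp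
  have hfν := isProbabilityMeasure_tilted hfexp
  have hgint := integrable_of_bounded (μ := μ.tilted g) hg hgb
  have hfint := integrable_of_bounded (μ := μ.tilted f) hf hfb
  have hg' := klDiv_tilted_ne_top hgexp hgint
  have hf' := klDiv_tilted_ne_top hfexp hfint
  have hle : ∫ x, g x ∂(μ.tilted g) + ∫ x, f x ∂(μ.tilted f) ≤
      (klDiv (μ.tilted g) μ).toReal + (klDiv (μ.tilted f) μ).toReal := by
    rw [← ENNReal.toReal_add hg' hf', ← ENNReal.ofReal_le_iff_le_toReal (by simp [hg', hf'])]
    exact (ofReal_integral_add_le_transportCost hgint hfint hgf).trans (h _ _ hgν hfν)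
  rw [toReal_klDiv_tilted hgexp hgint, toReal_klDiv_tilted hfexp hfint] at hle
  linarith

end PropertyTau

end TransportEntropy

theorem mainTheorem7_general {X : Type*} [TopologicalSpace X] [TopologicalSpace.MetrizableSpace X]
    [SecondCountableTopology X] [MeasurableSpace X] [BorelSpace X] [StandardBorelSpace X]
    (c : X × X → ℝ≥0) (hc : LowerSemicontinuous c) (μ : Measure X) [IsProbabilityMeasure μ] :
    TransportEntropy.PropertyTau μ c ↔
      ∀ ν₁ ν₂ : Measure X, IsProbabilityMeasure ν₁ → IsProbabilityMeasure ν₂ →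
        TransportEntropy.transportCost c ν₁ ν₂ ≤
          InformationTheory.klDiv ν₁ μ + InformationTheory.klDiv ν₂ μ :=
  ⟨fun hτ ν₁ ν₂ _ _ => hτ.transportCost_le hc ν₁ ν₂,
    TransportEntropy.propertyTau_of_transportCost_le⟩

theorem mainTheorem7 {X : Type*} [TopologicalSpace X] [PolishSpace X] [MeasurableSpace X]
    [BorelSpace X] (c : X × X → ℝ≥0) (hc : LowerSemicontinuous c)
    (μ : Measure X) [IsProbabilityMeasure μ] :
    TransportEntropy.PropertyTau μ c ↔
      ∀ ν₁ ν₂ : Measure X, IsProbabilityMeasure ν₁ → IsProbabilityMeasure ν₂ →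
        TransportEntropy.transportCost c ν₁ ν₂ ≤
          InformationTheory.klDiv ν₁ μ + InformationTheory.klDiv ν₂ μ :=
  mainTheorem7_general c hc μ
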